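/- Let $k$ be a field, $A=k[x_1,\dots,x_n]$ with its standard grading, $\mathfrak m=(x_1,\dots,x_n)$, and let $M=\bigoplus_{d\in\mathbb Z}M_d$ be a finitely generated graded $A$-module. Put $b_i(M):=\max\{\mu \mid \operatorname{Tor}^A_i(M,k)_\mu\neq 0\}$ (with $\max\emptyset=-\infty$; the graded module $\operatorname{Tor}^A_i(M,k)$ is the Koszul homology $H_i(x_1,\dots,x_n;M)$) and $\operatorname{reg}(M):=\max_i\{b_i(M)-i\}$, and let $H^0_{\mathfrak m}(M)$ be the submodule of the elements of $M$ killed by a power of $\mathfrak m$. Then for a general linear form $l$ and every integer $\mu\geq\max\{\operatorname{reg}(M/lM)+1,\ b_0(M),\ b_1(M)-1\}$, $$\operatorname{reg}(M)\leq \mu+\dim_k H^0_{\mathfrak m}(M)_\mu\leq \mu+\dim_k M_\mu .$$ Here "for a general linear form $l$" means: there is a nonzero polynomial $P\in k[c_1,\dots,c_n]$ such that the claim holds, for every such $\mu$, whenever $l=\sum_i c_ix_i$ has coefficients $c_i\in k$ with $P(c_1,\dots,c_n)\neq0$; moreover, with the same $P$, for every field extension $K$ of $k$ and all $c_i\in K$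 with $P(c_1,\dots,c_n)\neq 0$, the claim holds for $l=\sum_i c_ix_i$ and the graded $K[x_1,\dots,x_n]$-module $K\otimes_kM$ (with $\dim_K$) in place of $M$. -/

import Mathlib

open MvPolynomial

namespace CMReg

noncomputable section

/-- `ℳ` makes `M` a graded module over the polynomial ring `k[x_1, …, x_n]` with its standard
grading: `M` is the direct sum of the `k`-subspaces `ℳ d`, for `d` an integer, and
`A_e • ℳ d ⊆ ℳ (d + e)`. -/
structure IsGraded {k : Type*} [Field k] {n : ℕ} {M : Type*} [AddCommGroup M] [Module k M]
    [Module (MvPolynomial (Fin n) k) M] (ℳ : ℤ → Submodule k M) : Prop where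
  isInternal : DirectSum.IsInternal ℳ
  smul_mem : ∀ (e : ℕ) (d : ℤ) (a : MvPolynomial (Fin n) k) (m : M),
    a.IsHomogeneous e → m ∈ ℳ d → a • m ∈ ℳ (d + e)

section Koszul

open scoped Pointwise

variable {k : Type*} [Field k] {n : ℕ} {M : Type*} [AddCommGroup M] [Module k M]
  [Module (MvPolynomial (Fin n) k) M] [IsScalarTower k (MvPolynomial (Fin n) k) M]

variable (k n M) in
/-- The differential of the Koszul complex `K(x_1, …, x_n; M)`. A chain `∑ s, e_s ⊗ c s`, with
`e_s` the exterior product of the basis vectors `e_i`, `i ∈ s`, in increasing order, is encoded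
as the function `c`; the chains of homological degree `p` are those supported on the `s` with
`p` elements. The differential sends `e_s ⊗ m` to
`∑ i ∈ s, (-1) ^ #{j ∈ s | j < i} e_{s \ {i}} ⊗ x_i m`. -/
def koszulD : (Finset (Fin n) → M) →ₗ[k] (Finset (Fin n) → M) where
  toFun c t := ∑ i ∈ tᶜ, (-1 : ℤ) ^ (t.filter (· < i)).card •
    ((X i : MvPolynomial (Fin n) k) • c (insert i t))
  map_add' c c' := by
    funext t
    simp [smul_add, Finset.sum_add_distrib]
  map_smul' a c := by
    funext t
    simp only [Pi.smul_apply, RingHom.id_apply, Finset.smul_sum]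
    refine Finset.sum_congr rfl fun i _ => ?_
    rw [smul_comm a, ← algebraMap_smul (MvPolynomial (Fin n) k) a (c _), smul_smul, mul_comm,
      ← smul_smul, algebraMap_smul]

/-- The Koszul differential squares to zero. -/
theorem koszulD_koszulD (c : Finset (Fin n) → M) : koszulD k n M (koszulD k n M c) = 0 := by
  funext t
  simp only [koszulD, LinearMap.coe_mk, AddHom.coe_mk, Pi.zero_apply, Finset.smul_sum]
  rw [Finset.sum_sigma']
  refine Finset.sum_involution (fun p _ => ⟨p.2, p.1⟩) ?_ ?_ ?_ ?_
  · rintro ⟨i, j⟩ h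
    simp only [Finset.mem_sigma, Finset.mem_compl, Finset.mem_insert, not_or] at h
    obtain ⟨hi, hji, hj⟩ := h
    simp only [smul_comm (X _ : MvPolynomial (Fin n) k) ((-1:ℤ)^_) , smul_smul]
    rw [Finset.insert_comm i j, Finset.filter_insert, Finset.filter_insert,
      mul_comm (X j) (X i), ← add_smul]
    have e1 : ∀ a : Fin n, i ∉ t.filter (· < a) := by simp [hi]
    have e2 : ∀ a : Fin n, j ∉ t.filter (· < a) := by simp [hj]
    rcases lt_or_gt_of_ne hji with h | h
    · rw [if_neg h.not_gt, if_pos h, Finset.card_insert_of_notMem (e2 _)]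
      convert zero_smul ℤ _
      ring
    · rw [if_pos h, if_neg h.not_gt, Finset.card_insert_of_notMem (e1 _)]
      convert zero_smul ℤ _
      ring
  · rintro ⟨i, j⟩ h _ he
    simp only [Finset.mem_sigma, Finset.mem_compl, Finset.mem_insert, not_or] at h
    simp only [Sigma.mk.injEq] at he
    exact h.2.1 he.1
  · rintro ⟨i, j⟩ h
    simp only [Finset.mem_sigma, Finset.mem_compl, Finset.mem_insert, not_or] at h ⊢
    exact ⟨h.2.2, fun e => h.2.1 e.symm, h.1⟩
  · rintro ⟨i, j⟩ h
    rfl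

/-- The Koszul chains of homological degree `p` and internal degree `μ`
(each basis vector `e_i` has internal degree `1`). -/
def koszulChains (ℳ : ℤ → Submodule k M) (p : ℕ) (μ : ℤ) :
    Submodule k (Finset (Fin n) → M) where
  carrier := {c | ∀ s, (s.card = p → c s ∈ ℳ (μ - p)) ∧ (s.card ≠ p → c s = 0)}
  add_mem' := by
    intro c c' h h' s
    refine ⟨fun hs => add_mem ((h s).1 hs) ((h' s).1 hs), fun hs => ?_⟩
    rw [Pi.add_apply, (h s).2 hs, (h' s).2 hs, add_zero]
  zero_mem' := fun s => ⟨fun _ => zero_mem _, fun _ => rfl⟩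
  smul_mem' := by
    intro a c h s
    refine ⟨fun hs => Submodule.smul_mem _ a ((h s).1 hs), fun hs => ?_⟩
    rw [Pi.smul_apply, (h s).2 hs, smul_zero]

/-- The Koszul cycles of homological degree `p` and internal degree `μ`. -/
def koszulCycles (ℳ : ℤ → Submodule k M) (p : ℕ) (μ : ℤ) : Submodule k (Finset (Fin n) → M) :=
  koszulChains ℳ p μ ⊓ LinearMap.ker (koszulD k n M)

/-- The Koszul boundaries of homological degree `p` and internal degree `μ`. -/
def koszulBoundaries (ℳ : ℤ → Submodule k M) (p : ℕ) (μ : ℤ) :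
    Submodule k (Finset (Fin n) → M) :=
  (koszulChains ℳ (p + 1) μ).map (koszulD k n M)

theorem koszulBoundaries_le (ℳ : ℤ → Submodule k M) (h : IsGraded (n := n) ℳ) (p : ℕ) (μ : ℤ) :
    koszulBoundaries (n := n) ℳ p μ ≤ koszulCycles (n := n) ℳ p μ := by
  rintro _ ⟨c, hc, rfl⟩
  refine ⟨fun t => ⟨fun ht => ?_, fun ht => ?_⟩, koszulD_koszulD c⟩
  · refine sum_mem fun i hi => ?_
    have hi' : i ∉ t := by simpa using hi
    refine zsmul_mem ?_ _
    have := h.smul_mem 1 _ (X i) _ (isHomogeneous_X k i)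
      ((hc (insert i t)).1 (by rw [Finset.card_insert_of_notMem hi', ht]))
    convert this using 2
    push_cast; ring
  · refine Finset.sum_eq_zero fun i hi => ?_
    have hi' : i ∉ t := by simpa using hi
    rw [(hc (insert i t)).2 (by rw [Finset.card_insert_of_notMem hi']; omega)]
    simp

/-- `Tor_p^A(M, k)_μ` for `A = k[x_1, …, x_n]`, computed with the Koszul resolution of `k` over
`A`: the homology, in homological degree `p` and internal degree `μ`, of `K(x_1, …, x_n; M)`. -/
abbrev GrTor (ℳ : ℤ → Submodule k M) (p : ℕ) (μ : ℤ) : Type _ :=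
  ↥(koszulCycles (n := n) ℳ p μ) ⧸
    (koszulBoundaries (n := n) ℳ p μ).submoduleOf (koszulCycles (n := n) ℳ p μ)

variable (n) in
/-- `b_p(M) = max {μ | Tor_p^A(M, k)_μ ≠ 0}`, which is `-∞` if there is no such `μ`. -/
def maxDeg (ℳ : ℤ → Submodule k M) (p : ℕ) : EReal :=
  sSup {x : EReal | ∃ μ : ℤ, Nontrivial (GrTor (n := n) ℳ p μ) ∧ x = ((μ : ℝ) : EReal)}

variable (n) in
/-- The Castelnuovo-Mumford regularity `reg(M) = max_p {b_p(M) - p}`. -/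
def reg (ℳ : ℤ → Submodule k M) : EReal :=
  ⨆ p : ℕ, maxDeg n ℳ p - ((p : ℝ) : EReal)

variable (k n M) in
/-- `H^0_𝔪(M)`, the submodule of the elements killed by a power of `𝔪 = (x_1, …, x_n)`. -/
def H0 : Submodule (MvPolynomial (Fin n) k) M where
  carrier := {m | ∃ r : ℕ, ∀ a ∈ (Ideal.span (Set.range X) : Ideal (MvPolynomial (Fin n) k)) ^ r,
    a • m = 0}
  add_mem' := by
    rintro m m' ⟨r, h⟩ ⟨r', h'⟩
    refine ⟨max r r', fun a ha => ?_⟩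
    rw [smul_add, h a (Ideal.pow_le_pow_right (le_max_left r r') ha),
      h' a (Ideal.pow_le_pow_right (le_max_right r r') ha), add_zero]
  zero_mem' := ⟨0, fun a _ => smul_zero a⟩
  smul_mem' := by
    rintro a' m ⟨r, h⟩
    refine ⟨r, fun a ha => ?_⟩
    rw [smul_comm, h a ha, smul_zero]

variable (n) in
/-- The graded piece `H^0_𝔪(M)_μ`. -/
def H0deg (ℳ : ℤ → Submodule k M) (μ : ℤ) : Submodule k M :=
  (H0 k n M).restrictScalars k ⊓ ℳ μ

/-- The grading of `M / l M` induced by that of `M`: its piece of degree `d` is the image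
of `ℳ d`. -/
def quotGrading (ℳ : ℤ → Submodule k M) (l : MvPolynomial (Fin n) k) :
    ℤ → Submodule k (QuotSMulTop l M) :=
  fun d => (ℳ d).map
    ((Submodule.mkQ (l • (⊤ : Submodule (MvPolynomial (Fin n) k) M))).restrictScalars k)

/-- The linear form `c_1 x_1 + ⋯ + c_n x_n`. -/
def linearForm (c : Fin n → k) : MvPolynomial (Fin n) k := ∑ i, C (c i) * X i

end Koszul

/-- `f` exhibits the graded `K[x_1, …, x_n]`-module `N` as the base change `K ⊗_k M` of the graded
`k[x_1, …, x_n]`-module `M`, for a field extension `K` of `k`. (For `K = k` the identity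
of `M` is such a map.) -/
structure IsGradedBaseChange {k : Type*} [Field k] {n : ℕ} {M : Type*} [AddCommGroup M]
    [Module k M] [Module (MvPolynomial (Fin n) k) M]
    {K : Type*} [Field K] [Algebra k K] {N : Type*} [AddCommGroup N] [Module k N] [Module K N]
    [IsScalarTower k K N] [Module (MvPolynomial (Fin n) K) N]
    (ℳ : ℤ → Submodule k M) (𝒩 : ℤ → Submodule K N) (f : M →ₗ[k] N) : Prop where
  isBaseChange : IsBaseChange K f
  isGraded : IsGraded (n := n) 𝒩
  map_X_smul : ∀ (i : Fin n) (m : M),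
    f ((X i : MvPolynomial (Fin n) k) • m) = (X i : MvPolynomial (Fin n) K) • f m
  map_mem : ∀ (d : ℤ) (m : M), m ∈ ℳ d → f m ∈ 𝒩 d

theorem IsGradedBaseChange.refl {k : Type*} [Field k] {n : ℕ} {M : Type*} [AddCommGroup M] [Module k M]
    [Module (MvPolynomial (Fin n) k) M] (ℳ : ℤ → Submodule k M) (h : IsGraded (n := n) ℳ) :
    IsGradedBaseChange (n := n) ℳ ℳ (LinearMap.id) where
  isBaseChange := IsBaseChange.ofEquiv (LinearEquiv.refl k M)
  isGraded := h
  map_X_smul _ _ := rfl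
  map_mem _ _ h := h

end

end CMReg

/-! Write $Q=M/lM$, $\omega=\sum_i c_ie_i$ and $D$ for the Koszul differential. Everything rests on
$D\omega+\omega D=l$ (`koszulD_wedgeForm`) and on two facts about a general $l$.

Filter regularity: $(0:_Ml)\subseteq H^0_{\mathfrak m}(M)$, also after base change. A prime
filtration reduces this to a domain $D_0=A/\mathfrak p$ not killed by all $x_i$. As $K\otimes D_0$
need not be a domain, one takes a Noether normalization $B\subseteq D_0$: the generic form divides a
nonzero polynomial over $B$, and $K\otimes B$ is a domain acting without torsion on $K\otimes D_0$.
One nonvanishing coefficient of that polynomial yields $P$, which serves every $K$.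

Decay of $H^0_{\mathfrak m}(M)$: for $d\ge\mu>\operatorname{reg}Q$ one has $H^0_{\mathfrak
m}(Q)_d=0$, since a socle element would give top Koszul homology. Hence $l:H^0_{\mathfrak m}(M)_d\to
H^0_{\mathfrak m}(M)_{d+1}$ is onto, with kernel $(0:_Ml)_d$. If this kernel vanishes for one
$d\ge\mu$, it vanishes from then on (`eq_zero_of_linearForm_smul_eq_zero`, using the vanishing of
$\operatorname{Tor}_1(M)$ and $\operatorname{Tor}_2(Q)$); then $l$ is injective and nilpotent on
each element of $H^0_{\mathfrak m}(M)$ in these degrees, which is therefore zero there. So the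
dimension drops by at least one per degree until it is zero, and $H^0_{\mathfrak m}(M)_d=0$ for
$d\ge\mu+\dim H^0_{\mathfrak m}(M)_\mu$.

Beyond that degree $l$ is injective, and the vanishing of the Koszul homology of $Q$ passes to $M$:
a cycle has the form $Dw+ly$ with $lDy=0$, so $Dy=0$ and $ly=D(\omega y)$. -/

namespace CMReg

open scoped TensorProduct

/-! ### Generic nonzerodivisors on $K\otimes D$ -/

/-- A finite torsion-free module over a domain embeds in a free module of finite rank. -/
theorem exists_injective_linearMap_pi (B D : Type*) [CommRing B] [IsDomain B] [AddCommGroup D]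
    [Module B D] [Module.Finite B D] [Module.IsTorsionFree B D] :
    ∃ (r : ℕ) (φ : D →ₗ[B] (Fin r → B)), Function.Injective φ := by
  classical
  let F := FractionRing B
  let V := LocalizedModule (nonZeroDivisors B) D
  let ι : D →ₗ[B] V := LocalizedModule.mkLinearMap (nonZeroDivisors B) D
  have hι : Function.Injective ι := by
    rw [← LinearMap.ker_eq_bot, LinearMap.ker_eq_bot']
    intro m hm
    obtain ⟨s, hs⟩ := (IsLocalizedModule.eq_zero_iff (nonZeroDivisors B) ι).1 hm
    exact (smul_eq_zero.1 hs).resolve_left (nonZeroDivisors.ne_zero s.2)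
  obtain ⟨S, hS⟩ := Module.Finite.fg_top (R := B) (M := D)
  let b := Module.finBasis F V
  let φ : D →ₗ[B] (Fin (Module.finrank F V) → F) := (b.equivFun.toLinearMap.restrictScalars B) ∘ₗ ι
  have hφ : Function.Injective φ := b.equivFun.injective.comp hι
  -- A common denominator for all coordinates of all generators; multiplication by it moves the
  -- image of $D$ into $B^r$.
  obtain ⟨s, hs⟩ := IsLocalization.exist_integer_multiples (nonZeroDivisors B)
    (S ×ˢ (Finset.univ : Finset (Fin (Module.finrank F V)))) (fun p => φ p.1 p.2)
  have hs0 : algebraMap B F s ≠ 0 :=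
    IsFractionRing.to_map_ne_zero_of_mem_nonZeroDivisors s.2
  let j : (Fin (Module.finrank F V) → B) →ₗ[B] (Fin (Module.finrank F V) → F) :=
    (Algebra.linearMap B F).compLeft _
  have hj : Function.Injective j := fun x y h => funext fun i =>
    IsFractionRing.injective B F (congrFun h i)
  let ψ : D →ₗ[B] (Fin (Module.finrank F V) → F) := (s : B) • φ
  have hψ : Function.Injective ψ := by
    intro x y h
    refine hφ (funext fun i => ?_)
    have := congrFun h i
    simpa [ψ, Algebra.smul_def, hs0] using this
  have hr : ∀ d, ψ d ∈ LinearMap.range j := by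
    intro d
    have hd : d ∈ Submodule.span B (S : Set D) := hS ▸ Submodule.mem_top
    induction hd using Submodule.span_induction with
    | mem x hx =>
      choose u hu using fun i => hs (x, i) (by simpa using hx)
      exact ⟨u, funext fun i => by simpa [j, ψ] using hu i⟩
    | zero => simp
    | add x y _ _ hx hy => rw [map_add]; exact add_mem hx hy
    | smul a x _ hx => rw [map_smul]; exact Submodule.smul_mem _ _ hx
  have hc : Function.Injective (ψ.codRestrict _ hr) := fun x y h =>
    hψ (congrArg Subtype.val h)
  exact ⟨_, (LinearEquiv.ofInjective j hj).symm.toLinearMap ∘ₗ ψ.codRestrict _ hr,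
    (LinearEquiv.ofInjective j hj).symm.injective.comp hc⟩

/-- The base change of a `B`-linear map is linear over `K ⊗ B`. -/
theorem lTensor_map_mul {k K B D : Type*} [Field k] [Field K] [Algebra k K] [CommRing B]
    [Algebra k B] [CommRing D] [Algebra k D] [Algebra B D] [IsScalarTower k B D]
    (φ : D →ₗ[B] B) (g : K ⊗[k] B) (z : K ⊗[k] D) :
    (φ.restrictScalars k).lTensor K
      (Algebra.TensorProduct.map (AlgHom.id k K) (IsScalarTower.toAlgHom k B D) g * z) =
      g * (φ.restrictScalars k).lTensor K z := by
  induction g with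
  | zero => simp
  | add g g' hg hg' => rw [map_add, add_mul, map_add, hg, hg', add_mul]
  | tmul a b =>
    induction z with
    | zero => simp
    | add z z' hz hz' => rw [mul_add, map_add, hz, hz', map_add, mul_add]
    | tmul a' d =>
      simp [← Algebra.smul_def]

/-- If `D` is finite and torsion-free over the domain `B` and `K ⊗ B` is a domain, then
the nonzero elements of `K ⊗ B` act injectively on `K ⊗ D`. -/
theorem eq_zero_of_map_mul_eq_zero {k K B D : Type*} [Field k] [Field K] [Algebra k K] [CommRing B]
    [IsDomain B] [Algebra k B] [CommRing D] [Algebra k D] [Algebra B D] [IsScalarTower k B D]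
    [Module.Finite B D] [Module.IsTorsionFree B D] [IsDomain (K ⊗[k] B)]
    {g : K ⊗[k] B} (hg : g ≠ 0) {z : K ⊗[k] D}
    (h : Algebra.TensorProduct.map (AlgHom.id k K) (IsScalarTower.toAlgHom k B D) g * z = 0) :
    z = 0 := by
  obtain ⟨r, φ, hφ⟩ := exists_injective_linearMap_pi B D
  -- Each coordinate of $z$ lies in the domain $K\otimes B$ and is killed by $g\ne0$; flatness of
  -- $K$ over $k$ makes the coordinates jointly injective.
  have h1 : ∀ i, ((LinearMap.proj i ∘ₗ φ).restrictScalars k).lTensor K z = 0 := by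
    intro i
    have := lTensor_map_mul (k := k) (K := K) (LinearMap.proj i ∘ₗ φ) g z
    rw [h, map_zero] at this
    exact (mul_eq_zero.1 this.symm).resolve_left hg
  have hinj : Function.Injective ((φ.restrictScalars k).lTensor K) :=
    Module.Flat.lTensor_preserves_injective_linearMap _ hφ
  refine hinj ?_
  rw [map_zero]
  refine (TensorProduct.piRight k k K (fun _ : Fin r => B)).injective ?_
  rw [map_zero]
  funext i
  rw [Pi.zero_apply, ← h1 i]
  clear h h1
  induction z with
  | zero => simp
  | add z z' hz hz' => simp only [map_add, Pi.add_apply, hz, hz']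
  | tmul a d => simp [TensorProduct.piRight_apply]

/-- A nonzero polynomial in `c` with coefficients in `k[θ]` does not vanish in `K ⊗ k[θ]` at the
points of a nonempty Zariski open set. -/
theorem exists_eval_tensor_ne_zero {k : Type*} [Field k] {n d : ℕ}
    (g : MvPolynomial (Fin n) (MvPolynomial (Fin d) k)) (hg : g ≠ 0) :
    ∃ P : MvPolynomial (Fin n) k, P ≠ 0 ∧
      ∀ (K : Type*) [Field K] [Algebra k K] (c : Fin n → K), aeval c P ≠ 0 →
        eval₂ (Algebra.TensorProduct.includeRight : MvPolynomial (Fin d) k →ₐ[k]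
          K ⊗[k] MvPolynomial (Fin d) k).toRingHom (fun i => c i ⊗ₜ 1) g ≠ 0 := by
  classical
  obtain ⟨α, hα⟩ := MvPolynomial.ne_zero_iff.1 hg
  obtain ⟨β, hβ⟩ := MvPolynomial.ne_zero_iff.1 hα
  -- $P(c)$ is the coefficient of $\theta^\beta$ in $g(c)\in K[\theta]$, so $g(c)=0$ would force
  -- $P(c)=0$.
  refine ⟨∑ a ∈ g.support, monomial a (coeff β (coeff a g)), ?_, ?_⟩
  · refine MvPolynomial.ne_zero_iff.2 ⟨α, ?_⟩
    simpa [coeff_sum, coeff_monomial, hα] using hβ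
  · intro K _ _ c hP h0
    apply hP
    have := congrArg (fun z => coeff β (algebraTensorAlgEquiv k K z)) h0
    simp only [eval₂_eq, map_sum, coeff_sum, map_zero, coeff_zero] at this
    rw [map_sum, ← this]
    refine Finset.sum_congr rfl fun a _ => ?_
    rw [aeval_monomial]
    have e : (∏ i ∈ a.support, (c i ⊗ₜ[k] (1 : MvPolynomial (Fin d) k)) ^ a i) =
        (∏ i ∈ a.support, c i ^ a i) ⊗ₜ 1 := by
      have := map_prod (Algebra.TensorProduct.includeLeft : K →ₐ[k] K ⊗[k] MvPolynomial (Fin d) k)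
        (fun i => c i ^ a i) a.support
      simpa only [Algebra.TensorProduct.includeLeft_apply, Algebra.TensorProduct.tmul_pow,
        one_pow] using this.symm
    rw [e]
    simp [Finsupp.prod, coeff_map, mul_comm]

/-- Let `D` be a domain generated by finitely many elements over `k` and let `x₁, …, xₙ ∈ D`
not all vanish. Then the general combination of them is a nonzerodivisor on `K ⊗ D`. -/
theorem exists_forall_sum_mul_eq_zero {k : Type*} [Field k] {n : ℕ} (D : Type*) [CommRing D]
    [IsDomain D] [Algebra k D] [Algebra.FiniteType k D] (x : Fin n → D) (i₀ : Fin n)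
    (hx : x i₀ ≠ 0) :
    ∃ P : MvPolynomial (Fin n) k, P ≠ 0 ∧
      ∀ (K : Type*) [Field K] [Algebra k K] (c : Fin n → K), aeval c P ≠ 0 →
        ∀ z : K ⊗[k] D, (∑ i, c i ⊗ₜ[k] x i) * z = 0 → z = 0 := by
  classical
  obtain ⟨d, ι, hι, hfin⟩ := exists_finite_inj_algHom_of_fg k D
  algebraize [ι.toRingHom]
  have htower : IsScalarTower k (MvPolynomial (Fin d) k) D :=
    IsScalarTower.of_algebraMap_eq fun a => (ι.commutes a).symm
  have hfin' : Module.Finite (MvPolynomial (Fin d) k) D := hfin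
  have htf : Module.IsTorsionFree (MvPolynomial (Fin d) k) D :=
    Module.isTorsionFree_iff_algebraMap_injective.2 hι
  let m : MvPolynomial (Fin n) (MvPolynomial (Fin d) k) →+* MvPolynomial (Fin n) D :=
    MvPolynomial.map (algebraMap _ _)
  let L : MvPolynomial (Fin n) D := ∑ i, C (x i) * X i
  have hL : L ≠ 0 := by
    refine MvPolynomial.ne_zero_iff.2 ⟨Finsupp.single i₀ 1, ?_⟩
    have : coeff (Finsupp.single i₀ 1) L = x i₀ := by
      simp [L, coeff_sum, coeff_C_mul, coeff_X, Finsupp.single_left_inj]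
    rwa [this]
  let _ : Algebra (MvPolynomial (Fin n) (MvPolynomial (Fin d) k)) (MvPolynomial (Fin n) D) :=
    m.toAlgebra
  have hint : IsIntegral (MvPolynomial (Fin n) (MvPolynomial (Fin d) k)) L := by
    refine IsIntegral.sum _ fun i _ => IsIntegral.mul ?_ ?_
    · exact (Algebra.IsIntegral.isIntegral (R := MvPolynomial (Fin d) k) (x i)).map_of_comp_eq
        (C : MvPolynomial (Fin d) k →+* MvPolynomial (Fin n) (MvPolynomial (Fin d) k))
        (C : D →+* MvPolynomial (Fin n) D) (by
          ext a <;> simp [RingHom.algebraMap_toAlgebra, m])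
    · have : (X i : MvPolynomial (Fin n) D) = algebraMap
          (MvPolynomial (Fin n) (MvPolynomial (Fin d) k)) _ (X i) := by
        simp [RingHom.algebraMap_toAlgebra, m]
      rw [this]
      exact isIntegral_algebraMap
  -- A nonzero integral element of a domain has a nonzero multiple in the base, so some $g\ne0$ over
  -- $B$ is a multiple of the generic form $L$. If $g(c)$ is a nonzerodivisor, so is its factor
  -- $L(c)$.
  have hne := Ideal.comap_ne_bot_of_integral_mem (I := Ideal.span {L}) hL
    (Ideal.mem_span_singleton_self L) hint
  obtain ⟨g, hgI, hg⟩ := Submodule.exists_mem_ne_zero_of_ne_bot hne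
  obtain ⟨q, hq⟩ := Ideal.mem_span_singleton'.1 (Ideal.mem_comap.1 hgI)
  obtain ⟨P, hP, hPK⟩ := exists_eval_tensor_ne_zero g hg
  refine ⟨P, hP, fun K _ _ c hc z hz => ?_⟩
  have : IsDomain (K ⊗[k] MvPolynomial (Fin d) k) :=
    (algebraTensorAlgEquiv k K).toMulEquiv.isDomain _
  refine eq_zero_of_map_mul_eq_zero (hPK K c hc) ?_
  let e : MvPolynomial (Fin n) D →+* K ⊗[k] D :=
    eval₂Hom (Algebra.TensorProduct.includeRight : D →ₐ[k] K ⊗[k] D).toRingHom (fun i => c i ⊗ₜ 1)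
  have h1 : Algebra.TensorProduct.map (AlgHom.id k K)
      (IsScalarTower.toAlgHom k (MvPolynomial (Fin d) k) D)
      (eval₂ (Algebra.TensorProduct.includeRight : MvPolynomial (Fin d) k →ₐ[k]
          K ⊗[k] MvPolynomial (Fin d) k).toRingHom (fun i => c i ⊗ₜ 1) g) = e (m g) := by
    have : (Algebra.TensorProduct.map (AlgHom.id k K)
        (IsScalarTower.toAlgHom k (MvPolynomial (Fin d) k) D)).toRingHom.comp
        (eval₂Hom (Algebra.TensorProduct.includeRight : MvPolynomial (Fin d) k →ₐ[k]
          K ⊗[k] MvPolynomial (Fin d) k).toRingHom (fun i => c i ⊗ₜ 1)) = e.comp m := by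
      refine MvPolynomial.ringHom_ext (fun a => ?_) (fun i => ?_)
      · simp [e, m]
      · simp [e, m]
    exact DFunLike.congr_fun this g
  have h2 : e L = ∑ i, c i ⊗ₜ[k] x i := by
    simp [e, L, map_sum]
  have h3 : m g = q * L := hq.symm
  rw [h1, h3, map_mul, h2, mul_assoc, hz, mul_zero]

/-! ### Elements killed by a power of $\mathfrak m$ -/

section

variable {k : Type*} [Field k] {n : ℕ}

section

variable {M : Type*} [AddCommGroup M] [Module (MvPolynomial (Fin n) k) M]

/-- The radical of the annihilator of $m$ contains $\mathfrak m$, and $\mathfrak m$ is finitely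
generated. This lets membership be tested one variable at a time, which suits $K\otimes M$, where
only the operators `tensorX` are at hand. -/
theorem mem_H0_of_pow_smul_eq_zero {m : M}
    (h : ∀ i, ∃ r : ℕ, (X i : MvPolynomial (Fin n) k) ^ r • m = 0) : m ∈ H0 k n M := by
  have hle : (Ideal.span (Set.range X) : Ideal (MvPolynomial (Fin n) k)) ≤
      Ideal.radical (LinearMap.ker (LinearMap.toSpanSingleton (MvPolynomial (Fin n) k) M m)) := by
    rw [Ideal.span_le]
    rintro _ ⟨i, rfl⟩
    obtain ⟨r, hr⟩ := h i
    exact ⟨r, by simpa using hr⟩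
  obtain ⟨r, hr⟩ := Ideal.exists_pow_le_of_le_radical_of_fg hle
    (Submodule.fg_span (Set.finite_range X))
  exact ⟨r, fun a ha => by simpa using hr ha⟩

theorem exists_pow_smul_eq_zero {m : M} (h : m ∈ H0 k n M) {a : MvPolynomial (Fin n) k}
    (ha : a ∈ Ideal.span (Set.range (X : Fin n → MvPolynomial (Fin n) k))) :
    ∃ r : ℕ, a ^ r • m = 0 := by
  obtain ⟨r, hr⟩ := h
  exact ⟨r, hr _ (Ideal.pow_mem_pow ha r)⟩

theorem mem_H0_of_forall_mem_pow {m : M} (r : ℕ)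
    (h : ∀ a ∈ (Ideal.span (Set.range X) : Ideal (MvPolynomial (Fin n) k)) ^ r,
      a • m ∈ H0 k n M) : m ∈ H0 k n M := by
  refine mem_H0_of_pow_smul_eq_zero fun i => ?_
  obtain ⟨s, hs⟩ := exists_pow_smul_eq_zero
    (h (X i ^ r) (Ideal.pow_mem_pow (Ideal.subset_span (Set.mem_range_self i)) r))
    (Ideal.subset_span (Set.mem_range_self i))
  exact ⟨s + r, by rwa [pow_add, mul_smul]⟩

theorem linearForm_mem (c : Fin n → k) :
    linearForm c ∈ Ideal.span (Set.range (X : Fin n → MvPolynomial (Fin n) k)) :=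
  sum_mem fun i _ => Ideal.mul_mem_left _ _ (Ideal.subset_span ⟨i, rfl⟩)

end

/-! ### Filter regularity of the general linear form after base change -/

variable (k) (K : Type*) [Field K] [Algebra k K]

/-- Multiplication by `x_i` on `K ⊗ M`. -/
noncomputable def tensorX (M : Type*) [AddCommGroup M] [Module k M]
    [Module (MvPolynomial (Fin n) k) M] [IsScalarTower k (MvPolynomial (Fin n) k) M] (i : Fin n) :
    K ⊗[k] M →ₗ[K] K ⊗[k] M :=
  (Algebra.lsmul k k M (X i : MvPolynomial (Fin n) k)).baseChange K

section

variable {M : Type*} [AddCommGroup M] [Module k M]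
  [Module (MvPolynomial (Fin n) k) M] [IsScalarTower k (MvPolynomial (Fin n) k) M]
  {M' : Type*} [AddCommGroup M'] [Module k M']
  [Module (MvPolynomial (Fin n) k) M'] [IsScalarTower k (MvPolynomial (Fin n) k) M']

@[simp] theorem tensorX_tmul (i : Fin n) (a : K) (m : M) :
    tensorX k K M i (a ⊗ₜ m) = a ⊗ₜ ((X i : MvPolynomial (Fin n) k) • m) := rfl

theorem baseChange_tensorX (g : M →ₗ[MvPolynomial (Fin n) k] M') (i : Fin n) (z : K ⊗[k] M) :
    (g.restrictScalars k).baseChange K (tensorX k K M i z) =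
      tensorX k K M' i ((g.restrictScalars k).baseChange K z) := by
  induction z with
  | zero => simp
  | add z z' h h' => simp only [map_add, h, h']
  | tmul a m => simp

theorem baseChange_tensorX_pow (g : M →ₗ[MvPolynomial (Fin n) k] M') (i : Fin n) (r : ℕ)
    (z : K ⊗[k] M) :
    (g.restrictScalars k).baseChange K ((tensorX k K M i ^ r) z) =
      (tensorX k K M' i ^ r) ((g.restrictScalars k).baseChange K z) := by
  induction r with
  | zero => rfl
  | succ r ih => rw [pow_succ', pow_succ', Module.End.mul_apply, Module.End.mul_apply,
      baseChange_tensorX, ih]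

theorem tensorX_comm (i j : Fin n) (z : K ⊗[k] M) :
    tensorX k K M i (tensorX k K M j z) = tensorX k K M j (tensorX k K M i z) := by
  induction z with
  | zero => simp
  | add z z' h h' => simp only [map_add, h, h']
  | tmul a m => simp [smul_comm (X i : MvPolynomial (Fin n) k) (X j : MvPolynomial (Fin n) k) m]

theorem tensorX_pow_comm (i j : Fin n) (r : ℕ) (z : K ⊗[k] M) :
    tensorX k K M i ((tensorX k K M j ^ r) z) = (tensorX k K M j ^ r) (tensorX k K M i z) := by
  induction r with
  | zero => rfl
  | succ r ih => rw [pow_succ', Module.End.mul_apply, Module.End.mul_apply, tensorX_comm, ih]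

end

/-- The general linear form is filter regular on `K ⊗ M`, the form being general independently
of the extension `K` of `k`. -/
theorem exists_forall_tensorX_pow_eq_zero {k : Type*} [Field k] {n : ℕ} (M : Type*)
    [AddCommGroup M] [Module (MvPolynomial (Fin n) k) M] [Module.Finite (MvPolynomial (Fin n) k) M]
    [Module k M] [IsScalarTower k (MvPolynomial (Fin n) k) M] :
    ∃ P : MvPolynomial (Fin n) k, P ≠ 0 ∧
      ∀ (K : Type*) [Field K] [Algebra k K] (c : Fin n → K), aeval c P ≠ 0 →
        ∀ z : K ⊗[k] M, ∑ i, c i • tensorX k K M i z = 0 →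
          ∀ i : Fin n, ∃ r, (tensorX k K M i ^ r) z = 0 := by
  -- The induction varies the $A$-module, so the $k$-structure has to be quantified inside the
  -- statement.
  rename_i hk ht
  revert hk ht
  induction ‹Module.Finite (MvPolynomial (Fin n) k) M› using
    IsNoetherianRing.induction_on_isQuotientEquivQuotientPrime (MvPolynomial (Fin n) k) with
  | subsingleton N =>
    intro _ _
    refine ⟨1, one_ne_zero, fun K _ _ c _ z _ i => ⟨0, ?_⟩⟩
    have : Subsingleton (K ⊗[k] N) := inferInstance
    exact Subsingleton.elim _ _
  | quotient N p e =>
    intro _ _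
    by_cases hp : ∀ i, (X i : MvPolynomial (Fin n) k) ∈ p.1
    · refine ⟨1, one_ne_zero, fun K _ _ c _ z hz i => ⟨1, ?_⟩⟩
      clear hz
      have hX : ∀ m : N, (X i : MvPolynomial (Fin n) k) • m = 0 := by
        intro m
        refine e.injective ?_
        rw [map_smul, map_zero]
        obtain ⟨b, hb⟩ := Ideal.Quotient.mk_surjective (e m)
        rw [← hb, ← Ideal.Quotient.mk_eq_mk, ← Submodule.Quotient.mk_smul,
          Submodule.Quotient.mk_eq_zero]
        exact Ideal.mul_mem_right _ _ (hp i)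
      rw [pow_one]
      induction z with
      | zero => simp
      | add z z' h h' => rw [map_add, h, h', add_zero]
      | tmul a m => rw [tensorX_tmul, hX, TensorProduct.tmul_zero]
    · push Not at hp
      obtain ⟨i₀, hi₀⟩ := hp
      have := p.2
      obtain ⟨P, hP, hPK⟩ := exists_forall_sum_mul_eq_zero (k := k) (MvPolynomial (Fin n) k ⧸ p.1)
        (fun i => Ideal.Quotient.mk p.1 (X i)) i₀ (by rwa [Ne, Ideal.Quotient.eq_zero_iff_mem])
      refine ⟨P, hP, fun K _ _ c hc z hz i => ⟨0, ?_⟩⟩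
      have hinj : Function.Injective ((e.toLinearMap.restrictScalars k).baseChange K) :=
        Module.Flat.lTensor_preserves_injective_linearMap (M := K)
          (e.toLinearMap.restrictScalars k) e.injective
      refine hinj ?_
      rw [map_zero]
      refine hPK K c hc _ ?_
      rw [← map_zero ((e.toLinearMap.restrictScalars k).baseChange K), ← hz]
      clear hz
      induction z with
      | zero => simp
      | add z z' h h' =>
        simp only [pow_zero, Module.End.one_apply, map_add, mul_add, smul_add,
          Finset.sum_add_distrib] at h h' ⊢
        rw [h, h']
      | tmul a m =>
        simp only [pow_zero, Module.End.one_apply, map_sum, map_smul, tensorX_tmul,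
          LinearMap.baseChange_tmul, Finset.sum_mul, Algebra.TensorProduct.tmul_mul_tmul,
          TensorProduct.smul_tmul', smul_eq_mul, LinearMap.coe_restrictScalars,
          LinearEquiv.coe_coe, Algebra.smul_def]
        rfl
  | exact N₁ N₂ N₃ f g hf hg hfg h₁ h₃ =>
    intro _ _
    let _ : Module k N₁ := Module.compHom N₁ (algebraMap k (MvPolynomial (Fin n) k))
    let _ : Module k N₃ := Module.compHom N₃ (algebraMap k (MvPolynomial (Fin n) k))
    have : IsScalarTower k (MvPolynomial (Fin n) k) N₁ := IsScalarTower.of_algebraMap_smul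
      fun _ _ => rfl
    have : IsScalarTower k (MvPolynomial (Fin n) k) N₃ := IsScalarTower.of_algebraMap_smul
      fun _ _ => rfl
    obtain ⟨P₁, hP₁, hP₁K⟩ := h₁
    obtain ⟨P₃, hP₃, hP₃K⟩ := h₃
    -- If $lz=0$, the image of $z$ in $K\otimes N_3$ is killed by some $x_i^r$, so $x_i^rz$ comes
    -- from some $w$ in $K\otimes N_1$. Injectivity gives $lw=0$, hence $x_i^sw=0$ and
    -- $x_i^{s+r}z=0$.
    refine ⟨P₁ * P₃, mul_ne_zero hP₁ hP₃, fun K _ _ c hc z hz i => ?_⟩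
    rw [map_mul] at hc
    have hinj : Function.Injective ((f.restrictScalars k).baseChange K) :=
      Module.Flat.lTensor_preserves_injective_linearMap (M := K) (f.restrictScalars k) hf
    have hex : Function.Exact ((f.restrictScalars k).baseChange K)
        ((g.restrictScalars k).baseChange K) :=
      lTensor_exact K (f := f.restrictScalars k) (g := g.restrictScalars k) hfg hg
    obtain ⟨r, hr⟩ := hP₃K K c (right_ne_zero_of_mul hc) ((g.restrictScalars k).baseChange K z) (by
      have := congrArg ((g.restrictScalars k).baseChange K) hz
      simpa only [map_sum, map_smul, baseChange_tensorX, map_zero] using this) i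
    rw [← baseChange_tensorX_pow] at hr
    obtain ⟨w, hw⟩ := (hex _).1 hr
    obtain ⟨s, hs⟩ := hP₁K K c (left_ne_zero_of_mul hc) w (hinj (by
      have := congrArg (tensorX k K N₂ i ^ r) hz
      simpa only [map_sum, map_smul, baseChange_tensorX, hw, tensorX_pow_comm, map_zero]
        using this)) i
    refine ⟨s + r, ?_⟩
    rw [pow_add, Module.End.mul_apply, ← hw, ← baseChange_tensorX_pow, hs, map_zero]

/-- The general linear form is filter regular on every base change of `M`. -/
theorem exists_forall_mem_H0 {k : Type*} [Field k] {n : ℕ} (M : Type*)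
    [AddCommGroup M] [Module (MvPolynomial (Fin n) k) M] [Module.Finite (MvPolynomial (Fin n) k) M]
    [Module k M] [IsScalarTower k (MvPolynomial (Fin n) k) M] :
    ∃ P : MvPolynomial (Fin n) k, P ≠ 0 ∧
      ∀ (K : Type*) [Field K] [Algebra k K] (N : Type*) [AddCommGroup N] [Module k N] [Module K N]
        [IsScalarTower k K N] [Module (MvPolynomial (Fin n) K) N]
        [IsScalarTower K (MvPolynomial (Fin n) K) N] (f : M →ₗ[k] N), IsBaseChange K f →
        (∀ (i : Fin n) (m : M),
          f ((X i : MvPolynomial (Fin n) k) • m) = (X i : MvPolynomial (Fin n) K) • f m) →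
        ∀ c : Fin n → K, aeval c P ≠ 0 → ∀ z : N, linearForm c • z = 0 → z ∈ H0 K n N := by
  obtain ⟨P, hP, hPK⟩ := exists_forall_tensorX_pow_eq_zero (k := k) (n := n) M
  refine ⟨P, hP, fun K _ _ N _ _ _ _ _ _ f hf hX c hc z hz => ?_⟩
  have he : ∀ (i : Fin n) (w : K ⊗[k] M),
      hf.equiv (tensorX k K M i w) = (X i : MvPolynomial (Fin n) K) • hf.equiv w := by
    intro i w
    induction w with
    | zero => simp
    | add w w' h h' => simp only [map_add, h, h', smul_add]
    | tmul a m => simp only [tensorX_tmul, hf.equiv_tmul, hX, smul_comm a]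
  have hepow : ∀ (i : Fin n) (r : ℕ) (w : K ⊗[k] M),
      hf.equiv ((tensorX k K M i ^ r) w) = (X i : MvPolynomial (Fin n) K) ^ r • hf.equiv w := by
    intro i r w
    induction r with
    | zero => simp
    | succ r ih => rw [pow_succ', Module.End.mul_apply, he, ih, smul_smul, ← pow_succ']
  obtain ⟨w, rfl⟩ := hf.equiv.surjective z
  refine mem_H0_of_pow_smul_eq_zero fun i => ?_
  obtain ⟨r, hr⟩ := hPK K c hc w (hf.equiv.injective (by
    rw [map_zero, ← hz, map_sum, linearForm, Finset.sum_smul]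
    refine Finset.sum_congr rfl fun j _ => ?_
    rw [map_smul, he, mul_smul, ← algebraMap_smul (MvPolynomial (Fin n) K) (c j)]
    rfl)) i
  exact ⟨r, by rw [← hepow, hr, map_zero]⟩

/-- A base change of a finitely generated module is finitely generated. -/
theorem finite_of_isBaseChange {k : Type*} [Field k] {n : ℕ} {M : Type*}
    [AddCommGroup M] [Module (MvPolynomial (Fin n) k) M] [Module.Finite (MvPolynomial (Fin n) k) M]
    [Module k M] [IsScalarTower k (MvPolynomial (Fin n) k) M]
    {K : Type*} [Field K] [Algebra k K] {N : Type*} [AddCommGroup N] [Module k N] [Module K N]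
    [IsScalarTower k K N] [Module (MvPolynomial (Fin n) K) N]
    [IsScalarTower K (MvPolynomial (Fin n) K) N] {f : M →ₗ[k] N} (hf : IsBaseChange K f)
    (hX : ∀ (i : Fin n) (m : M),
      f ((X i : MvPolynomial (Fin n) k) • m) = (X i : MvPolynomial (Fin n) K) • f m) :
    Module.Finite (MvPolynomial (Fin n) K) N := by
  classical
  obtain ⟨S, hS⟩ := Module.Finite.fg_top (R := MvPolynomial (Fin n) k) (M := M)
  refine ⟨⟨S.image f, eq_top_iff.2 fun z _ => ?_⟩⟩
  have hfa : ∀ (a : MvPolynomial (Fin n) k) (m : M),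
      f (a • m) = MvPolynomial.map (algebraMap k K) a • f m := by
    intro a
    induction a using MvPolynomial.induction_on with
    | C a =>
      intro m
      rw [map_C, ← algebraMap_eq, ← algebraMap_eq, algebraMap_smul, algebraMap_smul, map_smul,
        algebraMap_smul]
    | add a b ha hb => intro m; simp only [add_smul, map_add, ha, hb]
    | mul_X a i ha => intro m; rw [mul_smul, ha, hX, map_mul, map_X, mul_smul]
  have hM : ∀ m, f m ∈ Submodule.span (MvPolynomial (Fin n) K) (S.image f : Set N) := by
    intro m
    have hm : m ∈ Submodule.span (MvPolynomial (Fin n) k) (S : Set M) := hS ▸ Submodule.mem_top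
    induction hm using Submodule.span_induction with
    | mem x hx => exact Submodule.subset_span (by simpa using ⟨x, hx, rfl⟩)
    | zero => simp
    | add x y _ _ hx hy => rw [map_add]; exact add_mem hx hy
    | smul a x _ hx => rw [hfa]; exact Submodule.smul_mem _ _ hx
  obtain ⟨w, rfl⟩ := hf.equiv.surjective z
  induction w with
  | zero => simp
  | add w w' h h' => rw [map_add]; exact add_mem (h trivial) (h' trivial)
  | tmul a m =>
    rw [hf.equiv_tmul, ← algebraMap_smul (MvPolynomial (Fin n) K) a]
    exact Submodule.smul_mem _ _ (hM m)

end

/-! ### Homogeneous components and finiteness of the graded pieces -/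

section Grading

variable {k : Type*} [Field k] {n : ℕ} {M : Type*} [AddCommGroup M] [Module k M]
  [Module (MvPolynomial (Fin n) k) M] {ℳ : ℤ → Submodule k M}

/-- The projection to the homogeneous component of degree `d`. -/
noncomputable def IsGraded.proj (h : IsGraded (n := n) ℳ) (d : ℤ) : M →ₗ[k] M :=
  (ℳ d).subtype ∘ₗ DirectSum.component k ℤ (fun d => ℳ d) d ∘ₗ
    (LinearEquiv.ofBijective (DirectSum.coeLinearMap ℳ) h.isInternal).symm.toLinearMap

theorem IsGraded.proj_mem (h : IsGraded (n := n) ℳ) (d : ℤ) (m : M) : h.proj d m ∈ ℳ d :=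
  Subtype.prop _

theorem IsGraded.symm_apply (h : IsGraded (n := n) ℳ) {d : ℤ} {m : M} (hm : m ∈ ℳ d) :
    (LinearEquiv.ofBijective (DirectSum.coeLinearMap ℳ) h.isInternal).symm m =
      DirectSum.lof k ℤ (fun d => ℳ d) d ⟨m, hm⟩ := by
  rw [LinearEquiv.symm_apply_eq]
  exact (DirectSum.coeLinearMap_lof ℳ d ⟨m, hm⟩).symm

theorem IsGraded.proj_eq_self (h : IsGraded (n := n) ℳ) {d : ℤ} {m : M} (hm : m ∈ ℳ d) :
    h.proj d m = m := by
  simp [IsGraded.proj, h.symm_apply hm, DirectSum.component.lof_self]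

theorem IsGraded.proj_eq_zero (h : IsGraded (n := n) ℳ) {d e : ℤ} (hde : e ≠ d) {m : M}
    (hm : m ∈ ℳ e) : h.proj d m = 0 := by
  simp [IsGraded.proj, h.symm_apply hm, DirectSum.component.of, hde]

theorem IsGraded.proj_smul (h : IsGraded (n := n) ℳ) (d : ℤ) {e : ℕ} {a : MvPolynomial (Fin n) k}
    (ha : a.IsHomogeneous e) (m : M) : h.proj (d + e) (a • m) = a • h.proj d m := by
  have hm : m ∈ ⨆ d, ℳ d := by
    rw [h.isInternal.submodule_iSup_eq_top]; trivial
  induction hm using Submodule.iSup_induction' with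
  | mem d' x hx =>
    by_cases hd : d' = d
    · subst hd
      rw [h.proj_eq_self (h.smul_mem e d' a x ha hx), h.proj_eq_self hx]
    · rw [h.proj_eq_zero (by simpa using hd) (h.smul_mem e d' a x ha hx),
        h.proj_eq_zero hd hx, smul_zero]
  | zero => simp
  | add x y _ _ hx hy => simp only [smul_add, map_add, hx, hy]

theorem linearForm_isHomogeneous (c : Fin n → k) : (linearForm c).IsHomogeneous 1 :=
  IsHomogeneous.sum _ _ _ fun i _ => by
    simpa using (isHomogeneous_C (Fin n) (c i)).mul (isHomogeneous_X k i)

theorem IsGraded.X_smul_mem (h : IsGraded (n := n) ℳ) {d : ℤ} (i : Fin n) {m : M} (hm : m ∈ ℳ d) :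
    (X i : MvPolynomial (Fin n) k) • m ∈ ℳ (d + 1) := by
  simpa using h.smul_mem 1 d _ m (isHomogeneous_X k i) hm

theorem IsGraded.linearForm_smul_mem (h : IsGraded (n := n) ℳ) {d : ℤ} (c : Fin n → k) {m : M}
    (hm : m ∈ ℳ d) : linearForm c • m ∈ ℳ (d + 1) := by
  simpa using h.smul_mem 1 d _ m (linearForm_isHomogeneous c) hm

open scoped Pointwise in
/-- A homogeneous multiple of `l` is `l` times a homogeneous element. -/
theorem IsGraded.exists_linearForm_smul_eq (h : IsGraded (n := n) ℳ) {d : ℤ} (c : Fin n → k) {m : M}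
    (hm : m ∈ ℳ d) (hl : m ∈ linearForm c • (⊤ : Submodule (MvPolynomial (Fin n) k) M)) :
    ∃ y ∈ ℳ (d - 1), linearForm c • y = m := by
  obtain ⟨y, -, rfl⟩ := (Submodule.mem_smul_pointwise_iff_exists _ _ _).1 hl
  refine ⟨h.proj (d - 1) y, h.proj_mem _ _, ?_⟩
  have := h.proj_smul (d - 1) (linearForm_isHomogeneous c) y
  rw [← this]
  simpa using h.proj_eq_self hm

/-- The graded pieces of a finitely generated graded module are finite-dimensional. -/
theorem IsGraded.finite [IsScalarTower k (MvPolynomial (Fin n) k) M]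
    [Module.Finite (MvPolynomial (Fin n) k) M]
    (h : IsGraded (n := n) ℳ) (d : ℤ) : Module.Finite k (ℳ d) := by
  classical
  obtain ⟨S, hS⟩ := Module.Finite.fg_top (R := MvPolynomial (Fin n) k) (M := M)
  -- The generators need not be homogeneous; it is enough that their components vanish in low
  -- degrees.
  have hlow : ∀ m : M, ∃ e₀ : ℤ, ∀ e < e₀, h.proj e m = 0 := by
    intro m
    have hm : m ∈ ⨆ d, ℳ d := by
      rw [h.isInternal.submodule_iSup_eq_top]; trivial
    induction hm using Submodule.iSup_induction' with
    | mem d x hx => exact ⟨d, fun e he => h.proj_eq_zero he.ne' hx⟩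
    | zero => exact ⟨0, fun e _ => map_zero _⟩
    | add x y _ _ hx hy =>
      obtain ⟨a, ha⟩ := hx
      obtain ⟨b, hb⟩ := hy
      refine ⟨min a b, fun e he => ?_⟩
      rw [map_add, ha e (lt_of_lt_of_le he (min_le_left _ _)),
        hb e (lt_of_lt_of_le he (min_le_right _ _)), add_zero]
  choose e₀ he₀ using hlow
  obtain ⟨B, hB⟩ : ∃ B : ℕ, ∀ g ∈ S, d - e₀ g ≤ B := by
    refine ⟨∑ g ∈ S, (d - e₀ g).toNat, fun g hg => ?_⟩
    calc d - e₀ g ≤ ((d - e₀ g).toNat : ℤ) := Int.self_le_toNat _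
      _ ≤ _ := by
        exact_mod_cast Finset.single_le_sum (f := fun g => (d - e₀ g).toNat)
          (fun _ _ => Nat.zero_le _) hg
  have hfin : Set.Finite {α : Fin n →₀ ℕ | α.degree ≤ B} := Finsupp.finite_of_degree_le B
  let W : Submodule k M := Submodule.span k
    ((fun p : (Fin n →₀ ℕ) × M => h.proj d (monomial p.1 (1 : k) • p.2)) ''
      ({α : Fin n →₀ ℕ | α.degree ≤ B} ×ˢ (S : Set M)))
  have hW : W.FG := Submodule.fg_span ((hfin.prod S.finite_toSet).image _)
  have hmon : ∀ α : Fin n →₀ ℕ, ∀ g ∈ S, h.proj d (monomial α (1 : k) • g) ∈ W := by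
    intro α g hg
    by_cases hα : α.degree ≤ B
    · exact Submodule.subset_span ⟨(α, g), ⟨hα, hg⟩, rfl⟩
    -- The degree $d$ part of $x^\alpha g$ is $x^\alpha$ times the part of $g$ in degree
    -- $d-|\alpha|$, which lies below all components of $g$ once $|\alpha|>B$.
    · have := h.proj_smul (d - α.degree) (isHomogeneous_monomial (1 : k) (rfl : α.degree = α.degree)) g
      rw [sub_add_cancel, he₀ g _ (by have := hB g hg; push Not at hα; zify at hα; linarith),
        smul_zero] at this
      rw [this]
      exact zero_mem _
  have hmul : ∀ m : M, ∀ a : MvPolynomial (Fin n) k, h.proj d (a • m) ∈ W := by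
    intro m
    have hm : m ∈ Submodule.span (MvPolynomial (Fin n) k) (S : Set M) := hS ▸ Submodule.mem_top
    induction hm using Submodule.span_induction with
    | mem x hx =>
      intro a
      rw [a.as_sum, Finset.sum_smul, map_sum]
      refine sum_mem fun α _ => ?_
      rw [← mul_one (coeff α a), ← smul_eq_mul, ← smul_monomial, smul_assoc, map_smul]
      exact W.smul_mem _ (hmon α x hx)
    | zero => simp
    | add x y _ _ hx hy => intro a; rw [smul_add, map_add]; exact add_mem (hx a) (hy a)
    | smul b x _ hx => intro a; rw [smul_smul]; exact hx _
  have hle : ℳ d ≤ W := by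
    intro m hm
    have := hmul m 1
    rwa [one_smul, h.proj_eq_self hm] at this
  have : Module.Finite k W := Module.Finite.iff_fg.2 hW
  exact Submodule.finiteDimensional_of_le hle

end Grading

/-! ### The Koszul complex and the homotopy $\omega\wedge-$ -/

section

variable {k : Type*} [Field k] {n : ℕ} {M : Type*} [AddCommGroup M] [Module k M]
  {ℳ : ℤ → Submodule k M}

theorem koszulChains_apply_mem {p : ℕ} {μ : ℤ} {y : Finset (Fin n) → M}
    (hy : y ∈ koszulChains ℳ p μ) (s : Finset (Fin n)) : y s ∈ ℳ (μ - p) := by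
  by_cases hs : s.card = p
  · exact (hy s).1 hs
  · rw [(hy s).2 hs]; exact zero_mem _

end

section Koszul

open scoped Pointwise

variable {k : Type*} [Field k] {n : ℕ} {M : Type*} [AddCommGroup M]
  [Module (MvPolynomial (Fin n) k) M]

variable (k n M) in
/-- The exterior product with `e_i` on the chains of the Koszul complex. -/
noncomputable def wedge (i : Fin n) :
    (Finset (Fin n) → M) →ₗ[MvPolynomial (Fin n) k] (Finset (Fin n) → M) where
  toFun y s := if i ∈ s then (-1 : ℤ) ^ (s.filter (· < i)).card • y (s.erase i) else 0
  map_add' y y' := by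
    funext s
    by_cases h : i ∈ s <;> simp [h]
  map_smul' a y := by
    funext s
    by_cases h : i ∈ s <;> simp [h, smul_comm a]

/-- The exterior product with `∑ c_i e_i` on the chains of the Koszul complex. -/
noncomputable def wedgeForm (c : Fin n → k) :
    (Finset (Fin n) → M) →ₗ[MvPolynomial (Fin n) k] (Finset (Fin n) → M) :=
  ∑ i, (C (c i) : MvPolynomial (Fin n) k) • wedge k n M i

theorem wedgeForm_apply (c : Fin n → k) (y : Finset (Fin n) → M) (s : Finset (Fin n)) :
    wedgeForm c y s = ∑ i, (C (c i) : MvPolynomial (Fin n) k) • wedge k n M i y s := by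
  simp [wedgeForm, LinearMap.sum_apply, Finset.sum_apply]

variable [Module k M] [IsScalarTower k (MvPolynomial (Fin n) k) M]

theorem koszulD_apply (y : Finset (Fin n) → M) (t : Finset (Fin n)) :
    koszulD k n M y t = ∑ i ∈ tᶜ, (-1 : ℤ) ^ (t.filter (· < i)).card •
      ((X i : MvPolynomial (Fin n) k) • y (insert i t)) := rfl

theorem koszulD_smul (a : MvPolynomial (Fin n) k) (y : Finset (Fin n) → M) :
    koszulD k n M (a • y) = a • koszulD k n M y := by
  funext t
  simp only [koszulD_apply, Pi.smul_apply, Finset.smul_sum]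
  exact Finset.sum_congr rfl fun i _ => by rw [smul_comm (X i) a, smul_comm a ((-1 : ℤ) ^ _)]

theorem koszulD_comp {M' : Type*} [AddCommGroup M'] [Module k M']
    [Module (MvPolynomial (Fin n) k) M'] [IsScalarTower k (MvPolynomial (Fin n) k) M']
    (g : M →ₗ[MvPolynomial (Fin n) k] M') (y : Finset (Fin n) → M) :
    koszulD k n M' (fun s => g (y s)) = fun t => g (koszulD k n M y t) := by
  funext t
  simp only [koszulD_apply, map_sum, map_zsmul, map_smul]

/-- The differential is contraction against $(x_1,\dots,x_n)$, an antiderivation, so $D(e_i\wedge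
y)=x_iy-e_i\wedge Dy$. -/
theorem koszulD_wedge (i : Fin n) (y : Finset (Fin n) → M) :
    koszulD k n M (wedge k n M i y) + wedge k n M i (koszulD k n M y) =
      (X i : MvPolynomial (Fin n) k) • y := by
  funext t
  simp only [Pi.add_apply, koszulD_apply, wedge, LinearMap.coe_mk, AddHom.coe_mk, Pi.smul_apply]
  -- For $i\in t$, the summand of index $i$ in $e_i\wedge Dy$ gives $x_iy$ and the others cancel in
  -- pairs; for $i\notin t$, only the summand of index $i$ in $D(e_i\wedge y)$ survives.
  by_cases hi : i ∈ t
  · obtain ⟨s, hs, rfl⟩ : ∃ s, i ∉ s ∧ t = insert i s :=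
      ⟨t.erase i, Finset.notMem_erase i t, (Finset.insert_erase hi).symm⟩
    rw [if_pos hi, Finset.erase_insert hs]
    have hc : sᶜ = insert i (insert i s)ᶜ := by
      ext j; by_cases hj : j = i <;> simp [hj, hs]
    have hf : ((insert i s).filter (· < i)).card = (s.filter (· < i)).card := by
      rw [Finset.filter_insert, if_neg (lt_irrefl i)]
    rw [hc, Finset.sum_insert (by simp), smul_add, smul_smul, hf, ← mul_pow, add_left_comm]
    simp only [mul_neg, mul_one, neg_neg, one_pow, one_smul]
    rw [add_eq_left, Finset.smul_sum, ← Finset.sum_add_distrib]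
    refine Finset.sum_eq_zero fun j hj => ?_
    simp only [Finset.mem_compl, Finset.mem_insert, not_or] at hj
    obtain ⟨hji, hjs⟩ := hj
    have hins : (insert j (insert i s)).erase i = insert j s := by
      rw [Finset.insert_comm, Finset.erase_insert (by simp [hs, Ne.symm hji])]
    have hfil : (insert j (insert i s)).filter (· < i) = (insert j s).filter (· < i) := by
      rw [Finset.insert_comm, Finset.filter_insert, if_neg (lt_irrefl i)]
    rw [if_pos (by simp), hins, hfil,
      smul_comm (X j : MvPolynomial (Fin n) k) ((-1 : ℤ) ^ _), smul_smul, smul_smul, ← add_smul]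
    have e1 : ∀ a : Fin n, i ∉ s.filter (· < a) := by simp [hs]
    have e2 : ∀ a : Fin n, j ∉ s.filter (· < a) := by simp [hjs]
    convert zero_smul ℤ _
    rw [Finset.filter_insert, Finset.filter_insert]
    rcases lt_or_gt_of_ne hji with h | h
    · rw [if_neg h.not_gt, if_pos h, Finset.card_insert_of_notMem (e2 _)]
      ring
    · rw [if_pos h, if_neg h.not_gt, Finset.card_insert_of_notMem (e1 _)]
      ring
  · rw [if_neg hi, add_zero, Finset.sum_eq_single_of_mem i (by simpa using hi)]
    · rw [if_pos (by simp), Finset.erase_insert hi, Finset.filter_insert, if_neg (lt_irrefl i),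
        smul_comm (X i : MvPolynomial (Fin n) k) ((-1 : ℤ) ^ _), smul_smul, ← mul_pow]
      simp
    · intro j _ hji
      rw [if_neg (by simp [hi, Ne.symm hji])]
      simp

/-- The exterior product with `∑ c_i e_i` is a homotopy from `0` to the multiplication
by `∑ c_i x_i`. -/
theorem koszulD_wedgeForm (c : Fin n → k) (y : Finset (Fin n) → M) :
    koszulD k n M (wedgeForm c y) + wedgeForm c (koszulD k n M y) = linearForm c • y := by
  simp only [wedgeForm, LinearMap.sum_apply, map_sum, LinearMap.smul_apply, koszulD_smul,
    linearForm, Finset.sum_smul, ← Finset.sum_add_distrib, mul_smul]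
  exact Finset.sum_congr rfl fun i _ => by rw [← smul_add, koszulD_wedge]

variable {ℳ : ℤ → Submodule k M}

theorem wedgeForm_mem (c : Fin n → k) {p : ℕ} {μ : ℤ}
    {y : Finset (Fin n) → M} (hy : y ∈ koszulChains ℳ p μ) :
    wedgeForm c y ∈ koszulChains ℳ (p + 1) (μ + 1) := by
  intro s
  refine ⟨fun hs => ?_, fun hs => ?_⟩
  · rw [wedgeForm_apply]
    refine sum_mem fun i _ => ?_
    rw [← algebraMap_eq, algebraMap_smul]
    refine Submodule.smul_mem _ _ ?_
    simp only [wedge, LinearMap.coe_mk, AddHom.coe_mk]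
    split_ifs with h
    · refine zsmul_mem ?_ _
      convert koszulChains_apply_mem hy (s.erase i) using 2
      push_cast; ring
    · exact zero_mem _
  · rw [wedgeForm_apply]
    refine Finset.sum_eq_zero fun i _ => ?_
    simp only [wedge, LinearMap.coe_mk, AddHom.coe_mk]
    split_ifs with h
    · rw [(hy (s.erase i)).2 (by have := Finset.card_erase_add_one h; omega)]
      simp
    · simp

/-- A coefficientwise form of degree preservation that does not mention homological degree $p-1$, so
that $p=0$ is covered as well. -/
theorem koszulD_apply_mem (h : IsGraded (n := n) ℳ) {p : ℕ} {μ : ℤ}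
    {y : Finset (Fin n) → M} (hy : y ∈ koszulChains ℳ p μ) (t : Finset (Fin n)) :
    koszulD k n M y t ∈ ℳ (μ - p + 1) :=
  sum_mem fun i _ => zsmul_mem (h.X_smul_mem i (koszulChains_apply_mem hy _)) _

theorem koszulD_mem (h : IsGraded (n := n) ℳ) {p : ℕ} {μ : ℤ}
    {y : Finset (Fin n) → M} (hy : y ∈ koszulChains ℳ (p + 1) μ) :
    koszulD k n M y ∈ koszulChains ℳ p μ :=
  (koszulBoundaries_le ℳ h p μ ⟨y, hy, rfl⟩).1

theorem nontrivial_grTor_iff {p : ℕ} {μ : ℤ} : Nontrivial (GrTor (n := n) ℳ p μ) ↔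
    ¬ koszulCycles (n := n) ℳ p μ ≤ koszulBoundaries (n := n) ℳ p μ := by
  rw [Submodule.Quotient.nontrivial_iff, ne_eq, Submodule.submoduleOf_eq_top]

/-- An element killed by a power of `𝔪` in a degree beyond the top Koszul homology vanishes. -/
theorem eq_zero_of_mem_H0 (hX : ∀ (d : ℤ) (i : Fin n), ∀ m ∈ ℳ d,
      (X i : MvPolynomial (Fin n) k) • m ∈ ℳ (d + 1)) {μ : ℤ}
    (hn : ∀ j : ℤ, μ ≤ j - n → koszulCycles (n := n) ℳ n j ≤ koszulBoundaries (n := n) ℳ n j)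
    {d : ℤ} (hd : μ ≤ d) {z : M} (hz : z ∈ ℳ d) (hz0 : z ∈ H0 k n M) : z = 0 := by
  classical
  obtain ⟨r, hr⟩ := hz0
  induction r generalizing d z with
  | zero => simpa using hr 1 (by simp)
  | succ r ih =>
    -- Since $x_iz$ is killed by one power of $\mathfrak m$ less, induction makes it zero, and $z$
    -- is a socle element.
    have hXz : ∀ i, (X i : MvPolynomial (Fin n) k) • z = 0 := fun i =>
      ih (hd.trans (by omega)) (hX d i z hz) fun a ha => by
        rw [smul_smul]
        exact hr _ (by rw [pow_succ]; exact Ideal.mul_mem_mul ha (Ideal.subset_span ⟨i, rfl⟩))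
    -- $e_1\wedge\dots\wedge e_n\otimes z$ is a cycle of internal degree $d+n$. It is a boundary,
    -- yet there are no nonzero chains in homological degree $n+1$.
    let y : Finset (Fin n) → M := fun s => if s = Finset.univ then z else 0
    have hy : y ∈ koszulCycles (n := n) ℳ n (d + n) := by
      refine ⟨fun s => ⟨fun _ => ?_, fun hs => ?_⟩, ?_⟩
      · simp only [y, add_sub_cancel_right]
        split_ifs
        exacts [hz, zero_mem _]
      · exact if_neg fun h => hs (by simp [h])
      · refine LinearMap.mem_ker.2 (funext fun t => Finset.sum_eq_zero fun i _ => ?_)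
        simp only [y]
        split_ifs
        · rw [hXz, smul_zero]
        · simp
    obtain ⟨w, hw, hwy⟩ := hn (d + n) (by omega) hy
    have hw0 : w = 0 := funext fun s => (hw s).2 (by
      have := Finset.card_le_univ s
      simp only [Fintype.card_fin] at this
      omega)
    have := congrFun hwy Finset.univ
    simpa [hw0, y] using this.symm

end Koszul

/-! ### The bound for a filter regular linear form -/

open scoped Pointwise

variable {k : Type*} [Field k] {n : ℕ} {M : Type*} [AddCommGroup M] [Module k M]
  [Module (MvPolynomial (Fin n) k) M] [IsScalarTower k (MvPolynomial (Fin n) k) M]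
  {ℳ : ℤ → Submodule k M}

/-- Nonzero homology at $(p,j)$ would give $j-p\le\operatorname{reg}\le\mu-1$; the extra one is what
includes the case $j-p=\mu$. -/
theorem koszulCycles_le_of_reg_add_one_le {μ : ℤ} (h : reg n ℳ + 1 ≤ ((μ : ℝ) : EReal)) {p : ℕ}
    {j : ℤ} (hj : μ ≤ j - p) :
    koszulCycles (n := n) ℳ p j ≤ koszulBoundaries (n := n) ℳ p j := by
  by_contra hnot
  have h1 : ((j : ℝ) : EReal) ≤ maxDeg n ℳ p :=
    le_sSup ⟨j, nontrivial_grTor_iff.2 hnot, rfl⟩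
  have h2 : ((j : ℝ) : EReal) - ((p : ℝ) : EReal) ≤ reg n ℳ :=
    (EReal.sub_le_sub h1 le_rfl).trans (le_iSup (fun p : ℕ => maxDeg n ℳ p - ((p : ℝ) : EReal)) p)
  have h3 : (((j : ℝ) - p + 1 : ℝ) : EReal) ≤ ((μ : ℝ) : EReal) := by
    refine le_trans ?_ h
    push_cast
    exact add_le_add h2 le_rfl
  rw [EReal.coe_le_coe_iff] at h3
  have : j - p + 1 ≤ μ := by exact_mod_cast h3
  omega

theorem koszulCycles_one_le_of_maxDeg_sub_one_le {μ : ℤ}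
    (h : maxDeg n ℳ 1 - 1 ≤ ((μ : ℝ) : EReal)) {j : ℤ} (hj : μ + 1 < j) :
    koszulCycles (n := n) ℳ 1 j ≤ koszulBoundaries (n := n) ℳ 1 j := by
  by_contra hnot
  have h1 : ((j : ℝ) : EReal) ≤ maxDeg n ℳ 1 :=
    le_sSup ⟨j, nontrivial_grTor_iff.2 hnot, rfl⟩
  have h3 : (((j : ℝ) - 1 : ℝ) : EReal) ≤ ((μ : ℝ) : EReal) := by
    refine le_trans ?_ h
    push_cast
    exact EReal.sub_le_sub h1 le_rfl
  rw [EReal.coe_le_coe_iff] at h3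
  have : j - 1 ≤ μ := by exact_mod_cast h3
  omega

theorem reg_le_of_forall_koszulCycles_le {r : ℤ} (h : ∀ (p : ℕ) (j : ℤ), r < j - p →
    koszulCycles (n := n) ℳ p j ≤ koszulBoundaries (n := n) ℳ p j) :
    reg n ℳ ≤ ((r : ℝ) : EReal) := by
  refine iSup_le fun p => EReal.sub_le_of_le_add ?_
  refine sSup_le ?_
  rintro _ ⟨j, hj, rfl⟩
  have hj' : j ≤ r + p := by
    by_contra hlt
    exact nontrivial_grTor_iff.1 hj (h p j (by omega))
  rw [← EReal.coe_add, EReal.coe_le_coe_iff]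
  exact_mod_cast hj'

variable {c : Fin n → k} {μ : ℤ}

/-- The socle argument on $M/lM$ needs only this compatibility of its pieces with the variables, not
that their sum is direct. -/
theorem quotGrading_X_smul_mem (h : IsGraded (n := n) ℳ) (l : MvPolynomial (Fin n) k) (d : ℤ)
    (i : Fin n) (m : QuotSMulTop l M) (hm : m ∈ quotGrading ℳ l d) :
    (X i : MvPolynomial (Fin n) k) • m ∈ quotGrading ℳ l (d + 1) := by
  obtain ⟨y, hy, rfl⟩ := hm
  exact ⟨X i • y, h.X_smul_mem i hy, rfl⟩

/-- In large degrees, `H^0_𝔪(M)` is `l` times itself. -/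
theorem exists_mem_H0_linearForm_smul_eq (h : IsGraded (n := n) ℳ)
    (hl : ∀ z : M, linearForm c • z = 0 → z ∈ H0 k n M)
    (hQ : ∀ (p : ℕ) (j : ℤ), μ ≤ j - p →
      koszulCycles (n := n) (quotGrading ℳ (linearForm c)) p j ≤
        koszulBoundaries (n := n) (quotGrading ℳ (linearForm c)) p j)
    {d : ℤ} (hd : μ ≤ d) {z : M} (hz : z ∈ ℳ d) (hz0 : z ∈ H0 k n M) :
    ∃ y ∈ ℳ (d - 1), y ∈ H0 k n M ∧ linearForm c • y = z := by
  have hzQ : Submodule.mkQ (linearForm c • (⊤ : Submodule (MvPolynomial (Fin n) k) M)) z = 0 := by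
    refine eq_zero_of_mem_H0 (quotGrading_X_smul_mem h _) (fun j hj => hQ n j hj) hd
      ⟨z, hz, rfl⟩ ?_
    obtain ⟨r, hr⟩ := hz0
    exact ⟨r, fun a ha => by rw [← map_smul, hr a ha, map_zero]⟩
  obtain ⟨y, hy, hyz⟩ := h.exists_linearForm_smul_eq c hz
    ((Submodule.Quotient.mk_eq_zero _).1 hzQ)
  refine ⟨y, hy, ?_, hyz⟩
  obtain ⟨r, hr⟩ := hz0
  -- For $a\in\mathfrak m^r$ one has $l(ay)=az=0$, so $ay$ is in $H^0_{\mathfrak m}(M)$ by filter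
  -- regularity.
  refine mem_H0_of_forall_mem_pow r fun a ha => hl _ ?_
  rw [smul_comm, hyz, hr a ha]

/-- A chain that is a cycle modulo `l` is a boundary modulo `l` in the degrees in which the Koszul
homology of `M / lM` vanishes. -/
theorem exists_eq_koszulD_add_smul (h : IsGraded (n := n) ℳ) {p : ℕ} {j : ℤ}
    (hQ : koszulCycles (n := n) (quotGrading ℳ (linearForm c)) p j ≤
        koszulBoundaries (n := n) (quotGrading ℳ (linearForm c)) p j)
    {y : Finset (Fin n) → M} (hy : y ∈ koszulChains ℳ p j)
    (hDy : ∀ t, koszulD k n M y t ∈ linearForm c • (⊤ : Submodule (MvPolynomial (Fin n) k) M)) :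
    ∃ w ∈ koszulChains ℳ (p + 1) j, ∃ v ∈ koszulChains ℳ p (j - 1),
      y = koszulD k n M w + linearForm c • v := by
  classical
  let π := Submodule.mkQ (linearForm c • (⊤ : Submodule (MvPolynomial (Fin n) k) M))
  have hyQ : (fun s => π (y s)) ∈ koszulCycles (n := n) (quotGrading ℳ (linearForm c)) p j := by
    refine ⟨fun s => ⟨fun hs => ⟨y s, (hy s).1 hs, rfl⟩, fun hs => ?_⟩, ?_⟩
    · simp only [(hy s).2 hs, map_zero]
    · refine (koszulD_comp π y).trans (funext fun t => ?_)
      exact (Submodule.Quotient.mk_eq_zero _).2 (hDy t)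
  obtain ⟨w', hw', hwy⟩ := hQ hyQ
  -- The bounding chain is lifted coefficientwise, with zero chosen off cardinality $p+1$ so that
  -- the lift is again a chain.
  have hlift : ∀ s, ∃ m ∈ ℳ (j - (p + 1 : ℕ)), (s.card ≠ p + 1 → m = 0) ∧ π m = w' s := by
    intro s
    by_cases hs : s.card = p + 1
    · obtain ⟨m, hm, hms⟩ := (hw' s).1 hs
      exact ⟨m, hm, fun hne => absurd hs hne, hms⟩
    · exact ⟨0, zero_mem _, fun _ => rfl, by rw [map_zero, (hw' s).2 hs]⟩
  choose w hwm hw0 hww using hlift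
  have hw : w ∈ koszulChains ℳ (p + 1) j := fun s => ⟨fun _ => hwm s, hw0 s⟩
  have hDw := koszulD_mem h hw
  have hdiff : ∀ s, ∃ m ∈ ℳ (j - 1 - p), (s.card ≠ p → m = 0) ∧
      linearForm c • m = y s - koszulD k n M w s := by
    intro s
    by_cases hs : s.card = p
    · have hmem : y s - koszulD k n M w s ∈ ℳ (j - p) :=
        sub_mem ((hy s).1 hs) ((hDw s).1 hs)
      have hπ : π (y s - koszulD k n M w s) = 0 := by
        have h1 := congrFun hwy s
        have h2 : (fun s => π (w s)) = w' := funext hww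
        rw [← h2, koszulD_comp] at h1
        rw [map_sub, sub_eq_zero]
        exact h1.symm
      obtain ⟨m, hm, hms⟩ := h.exists_linearForm_smul_eq c hmem
        ((Submodule.Quotient.mk_eq_zero _).1 hπ)
      refine ⟨m, ?_, fun hne => absurd hs hne, hms⟩
      convert hm using 2
      ring
    · exact ⟨0, zero_mem _, fun _ => rfl, by rw [smul_zero, (hy s).2 hs, (hDw s).2 hs, sub_zero]⟩
  choose v hvm hv0 hvv using hdiff
  refine ⟨w, hw, v, fun s => ⟨fun _ => hvm s, hv0 s⟩, funext fun s => ?_⟩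
  rw [Pi.add_apply, Pi.smul_apply, hvv, add_sub_cancel]

/-- The annihilator of `l` in `M` has no generators in large degrees. -/
theorem eq_zero_of_linearForm_smul_eq_zero (h : IsGraded (n := n) ℳ)
    (hl : ∀ z : M, linearForm c • z = 0 → z ∈ H0 k n M)
    (hQ : ∀ (p : ℕ) (j : ℤ), μ ≤ j - p →
      koszulCycles (n := n) (quotGrading ℳ (linearForm c)) p j ≤
        koszulBoundaries (n := n) (quotGrading ℳ (linearForm c)) p j)
    (h1 : ∀ j : ℤ, μ + 1 < j → koszulCycles (n := n) ℳ 1 j ≤ koszulBoundaries (n := n) ℳ 1 j)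
    {d : ℤ} (hd : μ ≤ d) (hK : ∀ y ∈ ℳ d, linearForm c • y = 0 → y = 0) {z : M}
    (hz : z ∈ ℳ (d + 1)) (hlz : linearForm c • z = 0) : z = 0 := by
  classical
  -- `ε m` is $m$ viewed as a $0$-chain; the homotopy then reads $D(\omega m)=lm$.
  let ε : M → Finset (Fin n) → M := fun m s => if s = ∅ then m else 0
  have hε : ∀ {m : M} {e : ℤ}, m ∈ ℳ e → ε m ∈ koszulChains ℳ 0 e := by
    intro m e hm s
    refine ⟨fun hs => ?_, fun hs => if_neg (by simpa using hs)⟩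
    simp only [ε, Finset.card_eq_zero.1 hs, if_true]
    simpa using hm
  have hDε : ∀ m, koszulD k n M (ε m) = 0 := by
    intro m
    funext t
    simp [koszulD_apply, ε]
  have hDω : ∀ m, koszulD k n M (wedgeForm c (ε m)) = linearForm c • ε m := by
    intro m
    have := koszulD_wedgeForm c (ε m)
    rwa [hDε, map_zero, add_zero] at this
  have hsmul : ∀ (a : MvPolynomial (Fin n) k) m, a • ε m = ε (a • m) := by
    intro a m
    funext s
    by_cases hs : s = ∅ <;> simp [ε, hs]
  have hε0 : ε 0 = 0 := by
    funext s
    simp [ε]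
  obtain ⟨z₁, hz₁, -, rfl⟩ := exists_mem_H0_linearForm_smul_eq h hl hQ (by omega : μ ≤ d + 1) hz
    (hl z hlz)
  rw [add_sub_cancel_right] at hz₁
  -- $\omega z$ is a $1$-cycle because $lz=0$; its internal degree $d+2$ exceeds $\mu+1$, so $\omega
  -- z=Du$.
  obtain ⟨u, hu, hDu⟩ := h1 (d + 1 + 1) (by omega)
    ⟨wedgeForm_mem c (hε hz), (hDω _).trans (by rw [hsmul, hlz, hε0])⟩
  -- With $z=lz_1$, $Du=l\,\omega z_1$ vanishes modulo $l$. As $(d+2)-2=d\ge\mu$,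
  -- $\operatorname{Tor}_2(M/lM)_{d+2}=0$ gives $u=Dv+lw$.
  obtain ⟨v, -, w, hw, rfl⟩ := exists_eq_koszulD_add_smul h (hQ 2 (d + 1 + 1) (by push_cast; omega))
    hu (fun t => by
      rw [hDu, ← hsmul, map_smul]
      exact Submodule.smul_mem_pointwise_smul _ _ _ trivial)
  rw [map_add, koszulD_koszulD, zero_add, koszulD_smul, ← hsmul, map_smul, ← sub_eq_zero,
    ← smul_sub] at hDu
  -- The coefficients are killed by $l$ and lie in degree $d$, where $l$ is injective. Applying $D$
  -- to $Dw=\omega z_1$ then gives $0=lz_1=z$.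
  have key : koszulD k n M w - wedgeForm c (ε z₁) = 0 := by
    funext t
    refine hK _ (sub_mem ?_ ?_) (congrFun hDu t)
    · convert koszulD_apply_mem h hw t using 2
      push_cast; ring
    · convert koszulChains_apply_mem (wedgeForm_mem c (hε hz₁)) t using 2
      push_cast; ring
  have h0 := congrArg (koszulD k n M) key
  rw [map_sub, koszulD_koszulD, hDω, map_zero, zero_sub, neg_eq_zero, hsmul] at h0
  simpa [ε] using congrFun h0 ∅

/-- The Koszul homology of `M` vanishes in the degrees in which that of `M / lM` and the
annihilator of `l` do. -/
theorem koszulCycles_le_koszulBoundaries (h : IsGraded (n := n) ℳ) {r : ℤ}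
    (hQ : ∀ (p : ℕ) (j : ℤ), r < j - p →
      koszulCycles (n := n) (quotGrading ℳ (linearForm c)) p j ≤
        koszulBoundaries (n := n) (quotGrading ℳ (linearForm c)) p j)
    (hK : ∀ d : ℤ, r < d → ∀ y ∈ ℳ d, linearForm c • y = 0 → y = 0) {p : ℕ} {j : ℤ}
    (hj : r < j - p) : koszulCycles (n := n) ℳ p j ≤ koszulBoundaries (n := n) ℳ p j := by
  rintro z ⟨hz, hDz⟩
  replace hDz : koszulD k n M z = 0 := hDz
  obtain ⟨w, hw, y, hy, rfl⟩ := exists_eq_koszulD_add_smul h (hQ p j hj) hz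
    (fun t => by rw [hDz]; exact zero_mem _)
  rw [map_add, koszulD_koszulD, zero_add, koszulD_smul] at hDz
  have hDy : koszulD k n M y = 0 := by
    funext t
    refine hK (j - p) hj _ ?_ (congrFun hDz t)
    convert koszulD_apply_mem h hy t using 2
    ring
  have hly := koszulD_wedgeForm c y
  rw [hDy, map_zero, add_zero] at hly
  refine ⟨w + wedgeForm c y, add_mem hw ?_, by rw [map_add, hly]⟩
  simpa using wedgeForm_mem c hy

/-- From degree `μ` on, the Hilbert function of `H^0_𝔪(M)` decreases strictly until it vanishes. -/
theorem H0deg_eq_bot (h : IsGraded (n := n) ℳ) [Module.Finite (MvPolynomial (Fin n) k) M]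
    (hl : ∀ z : M, linearForm c • z = 0 → z ∈ H0 k n M)
    (hQ : ∀ (p : ℕ) (j : ℤ), μ ≤ j - p →
      koszulCycles (n := n) (quotGrading ℳ (linearForm c)) p j ≤
        koszulBoundaries (n := n) (quotGrading ℳ (linearForm c)) p j)
    (h1 : ∀ j : ℤ, μ + 1 < j → koszulCycles (n := n) ℳ 1 j ≤ koszulBoundaries (n := n) ℳ 1 j)
    {d : ℤ} (hd : μ + Module.finrank k (H0deg n ℳ μ) ≤ d) : H0deg n ℳ d = ⊥ := by
  have hfin : ∀ d, Module.Finite k (H0deg n ℳ d) := fun d => by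
    have := h.finite d
    exact Submodule.finiteDimensional_of_le (inf_le_right : H0deg n ℳ d ≤ ℳ d)
  -- The bound contains the loss of at least one dimension per degree; the alternative records that
  -- once zero, $H^0_{\mathfrak m}(M)$ stays zero.
  have hstep : ∀ m : ℕ, Module.finrank k (H0deg n ℳ (μ + m)) + m ≤ Module.finrank k (H0deg n ℳ μ) ∨
      H0deg n ℳ (μ + m) = ⊥ := by
    intro m
    induction m with
    | zero => left; rw [Nat.cast_zero, add_zero, add_zero]
    | succ m ih =>
      let φ : H0deg n ℳ (μ + m) →ₗ[k] H0deg n ℳ (μ + m + 1) :=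
        (Algebra.lsmul k k M (linearForm c)).restrict fun z hz =>
          ⟨(H0 k n M).smul_mem _ hz.1, h.linearForm_smul_mem c hz.2⟩
      have hφ : Function.Surjective φ := by
        rintro ⟨z, hz⟩
        obtain ⟨y, hy, hy0, hyz⟩ := exists_mem_H0_linearForm_smul_eq h hl hQ
          (by omega : μ ≤ μ + m + 1) hz.2 hz.1
        rw [add_sub_cancel_right] at hy
        exact ⟨⟨y, hy0, hy⟩, Subtype.ext hyz⟩
      have hcast : μ + ((m + 1 : ℕ) : ℤ) = μ + m + 1 := by push_cast; ring
      rw [hcast]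
      rcases ih with ih | ih
      -- If $l$ is injective in degree $\mu+m$, so are all its powers from there on, while some
      -- power of $l$ kills any given element of $H^0_{\mathfrak m}(M)$. Otherwise the surjection
      -- $\varphi$ has a nonzero kernel and the dimension drops.
      · by_cases hK : ∀ y ∈ ℳ (μ + m), linearForm c • y = 0 → y = 0
        · right
          have hKe : ∀ e : ℕ, ∀ y ∈ ℳ (μ + m + e), linearForm c • y = 0 → y = 0 := by
            intro e
            induction e with
            | zero => simpa using hK
            | succ e ihe =>
              intro y hy hly
              refine eq_zero_of_linearForm_smul_eq_zero h hl hQ h1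
                (by omega : μ ≤ μ + m + e) ihe ?_ hly
              convert hy using 2
              push_cast; ring
          have hpow : ∀ (r e : ℕ), ∀ y ∈ ℳ (μ + m + e), linearForm c ^ r • y = 0 → y = 0 := by
            intro r
            induction r with
            | zero => intro e y _ hy; simpa using hy
            | succ r ihr =>
              intro e y hy hly
              refine hKe e y hy (ihr (e + 1) _ ?_ (by rwa [smul_smul, ← pow_succ]))
              convert h.linearForm_smul_mem c hy using 2
              push_cast; ring
          rw [eq_bot_iff]
          rintro z ⟨hz0, hz⟩
          obtain ⟨r, hr⟩ := exists_pow_smul_eq_zero hz0 (linearForm_mem c)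
          exact hpow r 1 z (by rwa [Nat.cast_one]) hr
        · left
          push Not at hK
          obtain ⟨y, hy, hly, hy0⟩ := hK
          have hker : 0 < Module.finrank k (LinearMap.ker φ) := by
            refine Module.finrank_pos_iff_exists_ne_zero.2
              ⟨⟨⟨y, hl y hly, hy⟩, Subtype.ext hly⟩, fun h0 => hy0 ?_⟩
            exact congrArg Subtype.val (congrArg Subtype.val h0)
          have hrank := φ.finrank_range_add_finrank_ker
          rw [LinearMap.range_eq_top.2 hφ, finrank_top] at hrank
          omega
      · right
        have : Subsingleton (H0deg n ℳ (μ + m)) := Submodule.subsingleton_iff_eq_bot.2 ih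
        exact Submodule.subsingleton_iff_eq_bot.1 hφ.subsingleton
  obtain ⟨m, rfl⟩ : ∃ m : ℕ, d = μ + m := ⟨(d - μ).toNat, by omega⟩
  rcases hstep m with hm | hm
  · refine Submodule.finrank_eq_zero.1 ?_
    omega
  · exact hm

/-- The bound on the regularity, for a filter regular linear form. -/
theorem reg_le_add_finrank_H0deg (h : IsGraded (n := n) ℳ) [Module.Finite (MvPolynomial (Fin n) k) M]
    (hl : ∀ z : M, linearForm c • z = 0 → z ∈ H0 k n M)
    (hQ : reg n (quotGrading ℳ (linearForm c)) + 1 ≤ ((μ : ℝ) : EReal))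
    (h1 : maxDeg n ℳ 1 - 1 ≤ ((μ : ℝ) : EReal)) :
    reg n ℳ ≤ (((μ + Module.finrank k (H0deg n ℳ μ) : ℤ) : ℝ) : EReal) := by
  refine reg_le_of_forall_koszulCycles_le fun p j hj => koszulCycles_le_koszulBoundaries h
    (fun p j hj => koszulCycles_le_of_reg_add_one_le hQ (by omega)) (fun d hd y hy hly => ?_) hj
  have := H0deg_eq_bot h hl (fun p j hj => koszulCycles_le_of_reg_add_one_le hQ hj)
    (fun j hj => koszulCycles_one_le_of_maxDeg_sub_one_le h1 hj) hd.le
  rw [← Submodule.mem_bot k, ← this]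
  exact ⟨hl y hly, hy⟩

end CMReg

theorem proposition2p6 {k : Type*} [Field k] {n : ℕ} {M : Type*} [AddCommGroup M] [Module k M]
    [Module (MvPolynomial (Fin n) k) M] [IsScalarTower k (MvPolynomial (Fin n) k) M]
    [Module.Finite (MvPolynomial (Fin n) k) M]
    (ℳ : ℤ → Submodule k M) (hℳ : CMReg.IsGraded (n := n) ℳ) :
    -- a nonempty Zariski open subset of the space of linear forms: the set where `P ≠ 0`
    ∃ P : MvPolynomial (Fin n) k, P ≠ 0 ∧
      -- a linear form `l` in it, over `k` or over an extension `K` of `k`; `N` is `K ⊗ M`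
      ∀ (K : Type*) [Field K] [Algebra k K] (N : Type*) [AddCommGroup N] [Module k N] [Module K N]
        [IsScalarTower k K N] [Module (MvPolynomial (Fin n) K) N]
        [IsScalarTower K (MvPolynomial (Fin n) K) N]
        (𝒩 : ℤ → Submodule K N) (f : M →ₗ[k] N),
        CMReg.IsGradedBaseChange (n := n) ℳ 𝒩 f →
        ∀ c : Fin n → K, MvPolynomial.aeval c P ≠ 0 →
        ∀ μ : ℤ,
          max (CMReg.reg n (CMReg.quotGrading 𝒩 (CMReg.linearForm c)) + 1)
              (max (CMReg.maxDeg n 𝒩 0) (CMReg.maxDeg n 𝒩 1 - 1)) ≤ ((μ : ℝ) : EReal) →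
          CMReg.reg n 𝒩 ≤ (((μ + Module.finrank K (CMReg.H0deg n 𝒩 μ) : ℤ) : ℝ) : EReal) ∧
          μ + Module.finrank K (CMReg.H0deg n 𝒩 μ) ≤ μ + Module.finrank K (𝒩 μ) := by
  obtain ⟨P, hP, hPK⟩ := CMReg.exists_forall_mem_H0 (k := k) (n := n) M
  refine ⟨P, hP, fun K _ _ N _ _ _ _ _ _ 𝒩 f hf c hc μ hμ => ?_⟩
  have := CMReg.finite_of_isBaseChange hf.isBaseChange hf.map_X_smul
  have hfin := hf.isGraded.finite μ
  rw [max_le_iff, max_le_iff] at hμ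
  refine ⟨CMReg.reg_le_add_finrank_H0deg hf.isGraded
    (hPK K N f hf.isBaseChange hf.map_X_smul c hc) hμ.1 hμ.2.2, ?_⟩
  have hle : Module.finrank K (CMReg.H0deg n 𝒩 μ) ≤ Module.finrank K (𝒩 μ) :=
    Submodule.finrank_mono inf_le_right
  omega
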